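/- Let $p$ be an odd prime, $\zeta_{2p}=e^{2\pi i/(2p)}$, and let $M$ be the set of all $2p$-th roots of unity in the ring $\mathbb{Z}[\zeta_{2p}]$, which is a free abelian group of finite rank $r$ and is generated by $M$ as a monoid under addition. For $n\ge 0$ let $S(n)$ be the (finite) number of elements of $\mathbb{Z}[\zeta_{2p}]$ of word length $n$ with respect to $M$, i.e. those for which $n$ is the least number of terms in an expression as a sum of (not necessarily distinct) elements of $M$. Then the growth series satisfies $$\sum_{n\ge 0}S(n)x^n=\frac{h_{2p}(x)}{(1-x)^{r}},$$ where the coordinator polynomial $h_{2p}(x)$, which has degree at most $r$, equals $$h_{2p}(x)=\sum_{k=0}^{(p-3)/2}\left(x^k+x^{p-1-k}\right)\sum_{j=0}^{k}\binom{p}{j}+x^{(p-1)/2}\sum_{j=0}^{(p-1)/2}\binom{p}{j}.$$ Moreover, the coefficient of $x^{(p-1)/2}$ in $h_{2p}(x)$ equals $2^{p-1}$. -/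

import Mathlib

open Polynomial

/-- `x` is a sum of exactly `n` (not necessarily distinct) elements of `M`. -/
def IsSumOf {L : Type*} [AddCommGroup L] (M : Set L) (n : ℕ) (x : L) : Prop :=
  ∃ s : Multiset L, (∀ y ∈ s, y ∈ M) ∧ Multiset.card s = n ∧ s.sum = x

/-- The elements of `L` of word length `n` with respect to `M`: `n` is the smallest number of
terms in an expression of the element as a sum of elements of `M`. -/
def wordSphere {L : Type*} [AddCommGroup L] (M : Set L) (n : ℕ) : Set L :=
  {x | IsLeast {k : ℕ | IsSumOf M k x} n}

/-- The coordination sequence `S(n)` of `(L, M)`. -/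
noncomputable def coordinationSequence {L : Type*} [AddCommGroup L] (M : Set L) (n : ℕ) : ℕ :=
  (wordSphere M n).ncard

/-- The growth series `G(x) = ∑ S(n) xⁿ` of `(L, M)`. -/
noncomputable def growthSeries {L : Type*} [AddCommGroup L] (M : Set L) : PowerSeries ℤ :=
  PowerSeries.mk fun n => (coordinationSequence M n : ℤ)

/-- `h` is the coordinator polynomial of `(L, M)`: `L` is a lattice (a free abelian group of
finite rank `r`), `M` generates `L` as a monoid, there are only finitely many elements of each word
length, `h` has degree at most `r`, and `G(x) = h(x) / (1 - x)^r`. -/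
structure IsCoordinatorPolynomial (L : Type*) [AddCommGroup L] (M : Set L) (h : ℤ[X]) : Prop where
  free : Module.Free ℤ L
  finite : Module.Finite ℤ L
  generates : AddSubmonoid.closure M = ⊤
  finite_sphere : ∀ n, (wordSphere M n).Finite
  natDegree_le : h.natDegree ≤ Module.finrank ℤ L
  growth_eq : growthSeries M * (1 - PowerSeries.X) ^ Module.finrank ℤ L = (h : PowerSeries ℤ)

/-- The coordinator polynomial is unique. -/
theorem IsCoordinatorPolynomial.unique {L : Type*} [AddCommGroup L] {M : Set L} {h h' : ℤ[X]}
    (H : IsCoordinatorPolynomial L M h) (H' : IsCoordinatorPolynomial L M h') : h = h' :=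
  Polynomial.coe_injective ℤ (H.growth_eq.symm.trans H'.growth_eq)

/-- The ring `ℤ[ζ_m]`, where `ζ_m = e^{2πi/m}`, as a subring of `ℂ`. -/
noncomputable def cyclotomicLattice (m : ℕ) : Subalgebra ℤ ℂ :=
  Algebra.adjoin ℤ {Complex.exp (2 * Real.pi * Complex.I / m)}

/-- The set of all `m`-th roots of unity in `ℤ[ζ_m]`. -/
def cyclotomicGenerators (m : ℕ) : Set (cyclotomicLattice m) :=
  {x | x ^ m = 1}

/-! Put `ζ = ζ_{2p}²`, a primitive `p`-th root of unity. The generators are `±ζ^i`, and the only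
relations among `1, ζ, …, ζ^(p-1)` are multiples of their sum, so the lattice is `ℤ^p` modulo
constant vectors. Word length is then the least ℓ¹ norm in a coset `a + t(1,…,1)`. As `p` is odd,
the minimiser is unique: it is the representative with median zero, i.e. with balanced signs
(`wordSphere_eq_image`, `injOn_sum_zsmul_balanced`).

Hence the growth series is a sum over balanced sign vectors of a product of weights, `1` for a zero
entry and `x/(1-x)` for a nonzero one. Multiplying by `(1-x)^p` turns these into `1-x` and `x`. All
sign vectors together give `(1+x)^p`; removing those with a positive or a negative majority leaves
the lower half of the binomial expansion minus the upper half (`balancedSum_eq`). Dividing by `1-x`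
yields the partial binomial sums (`one_sub_X_mul_halfBinomialPolynomial`). -/

namespace IsSumOf

variable {L : Type*} [AddCommGroup L] {M : Set L}

theorem zero : IsSumOf M 0 0 := ⟨0, by simp, by simp, by simp⟩

theorem of_mem {y : L} (hy : y ∈ M) : IsSumOf M 1 y := ⟨{y}, by simpa using hy, by simp, by simp⟩

theorem add {m n : ℕ} {x y : L} (hx : IsSumOf M m x) (hy : IsSumOf M n y) :
    IsSumOf M (m + n) (x + y) := by
  obtain ⟨s, hs, hsc, rfl⟩ := hx
  obtain ⟨t, ht, htc, rfl⟩ := hy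
  refine ⟨s + t, fun z hz => ?_, by simp [hsc, htc], by simp⟩
  rcases Multiset.mem_add.1 hz with h | h
  exacts [hs z h, ht z h]

theorem nsmul {y : L} (hy : y ∈ M) (n : ℕ) : IsSumOf M n (n • y) := by
  induction n with
  | zero => simpa using zero
  | succ n ih => simpa [succ_nsmul] using ih.add (of_mem hy)

theorem zsmul {y : L} (hy : y ∈ M) (hy' : -y ∈ M) (a : ℤ) : IsSumOf M a.natAbs (a • y) := by
  rcases Int.natAbs_eq a with h | h <;> rw [h]
  · rw [natCast_zsmul, Int.natAbs_natCast]
    exact nsmul hy _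
  · rw [neg_zsmul, natCast_zsmul, ← smul_neg, Int.natAbs_neg, Int.natAbs_natCast]
    exact nsmul hy' _

theorem sum {ι : Type*} (s : Finset ι) {n : ι → ℕ} {x : ι → L}
    (h : ∀ i ∈ s, IsSumOf M (n i) (x i)) : IsSumOf M (∑ i ∈ s, n i) (∑ i ∈ s, x i) := by
  classical
  induction s using Finset.induction_on with
  | empty => simpa using zero
  | insert i s hi ih =>
    rw [Finset.sum_insert hi, Finset.sum_insert hi]
    exact (h i (by simp)).add (ih fun j hj => h j (by simp [hj]))

end IsSumOf

/-! ### Balanced vectors minimise the ℓ¹ norm along constant shifts -/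

/-- A sign vector is balanced if fewer than half of its entries are positive and fewer than half
are negative. -/
def IsBalanced {ι : Type*} [Fintype ι] (σ : ι → SignType) : Prop :=
  ∀ e : SignType, e ≠ 0 → 2 * (Finset.univ.filter fun i => σ i = e).card < Fintype.card ι

theorem sign_comp_neg {ι : Type*} (a : ι → ℤ) : (fun i => SignType.sign ((-a) i)) =
    -fun i => SignType.sign (a i) := by
  funext i
  simp [Left.sign_neg]

section Median

variable {ι : Type*} [Fintype ι]

theorem IsBalanced.neg {σ : ι → SignType} (h : IsBalanced σ) : IsBalanced (-σ) := by
  intro e he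
  simpa [neg_eq_iff_eq_neg] using h (-e) (by simpa using he)

/-- A shift by `t > 0` lowers `|a i|` by at most `t` at negative entries and raises it by exactly
`t` at the others, which are in the majority. -/
theorem sum_natAbs_lt_add_of_pos {a : ι → ℤ} (ha : IsBalanced fun i => SignType.sign (a i))
    {t : ℤ} (ht : 0 < t) : ∑ i, (a i).natAbs < ∑ i, (a i + t).natAbs := by
  have h := ha (-1) (by decide)
  have key : ∀ i, ((a i).natAbs : ℤ) + t * (1 - 2 * if SignType.sign (a i) = -1 then 1 else 0) ≤
      ((a i + t).natAbs : ℤ) := by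
    intro i
    by_cases hi : a i < 0
    · simp only [sign_eq_neg_one_iff, hi, if_true]
      omega
    · simp only [sign_eq_neg_one_iff, hi, if_false]
      omega
  have hs := Finset.sum_le_sum fun i (_ : i ∈ Finset.univ) => key i
  rw [Finset.sum_add_distrib, ← Finset.mul_sum, Finset.sum_sub_distrib, ← Finset.mul_sum,
    Finset.sum_boole] at hs
  simp only [Finset.sum_const, Finset.card_univ, nsmul_eq_mul, mul_one] at hs
  zify at h ⊢
  simp only [Int.natCast_natAbs] at hs
  nlinarith

theorem sum_natAbs_lt_add {a : ι → ℤ} (ha : IsBalanced fun i => SignType.sign (a i))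
    {t : ℤ} (ht : t ≠ 0) : ∑ i, (a i).natAbs < ∑ i, (a i + t).natAbs := by
  rcases ht.lt_or_gt with h | h
  · have := sum_natAbs_lt_add_of_pos (a := -a) (t := -t)
      (by rw [sign_comp_neg]; exact ha.neg) (by omega)
    refine lt_of_eq_of_lt ?_ (this.trans_eq ?_)
    · simp
    · refine Finset.sum_congr rfl fun i _ => ?_
      rw [Pi.neg_apply, ← neg_add, Int.natAbs_neg]
  · exact sum_natAbs_lt_add_of_pos ha h

/-- Shifting by `-1` gains one at each positive entry and loses one elsewhere, so positives cannot
exceed half; odd size excludes equality. -/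
theorem pos_balanced_of_sum_natAbs_le (hι : Odd (Fintype.card ι)) {a : ι → ℤ}
    (ha : ∑ i, (a i).natAbs ≤ ∑ i, (a i - 1).natAbs) :
    2 * (Finset.univ.filter fun i => SignType.sign (a i) = 1).card < Fintype.card ι := by
  by_contra hlt
  have hne : 2 * (Finset.univ.filter fun i => SignType.sign (a i) = 1).card ≠ Fintype.card ι := by
    intro h
    exact (Nat.not_even_iff_odd.2 hι) (h ▸ even_two_mul _)
  have key : ∀ i, ((a i - 1).natAbs : ℤ) ≤
      (a i).natAbs + (1 - 2 * if SignType.sign (a i) = 1 then 1 else 0) := by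
    intro i
    by_cases hi : 0 < a i
    · simp only [sign_eq_one_iff, hi, if_true]
      omega
    · simp only [sign_eq_one_iff, hi, if_false]
      omega
  have hs := Finset.sum_le_sum fun i (_ : i ∈ Finset.univ) => key i
  rw [Finset.sum_add_distrib, Finset.sum_sub_distrib, ← Finset.mul_sum, Finset.sum_boole] at hs
  simp only [Finset.sum_const, Finset.card_univ, nsmul_eq_mul, mul_one] at hs
  zify at ha hne hlt
  simp only [Int.natCast_natAbs] at hs
  omega

theorem isBalanced_of_sum_natAbs_le (hι : Odd (Fintype.card ι)) {a : ι → ℤ}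
    (ha : ∀ t : ℤ, ∑ i, (a i).natAbs ≤ ∑ i, (a i + t).natAbs) :
    IsBalanced fun i => SignType.sign (a i) := by
  intro e he
  have h : e = 1 ∨ e = -1 := by revert e; decide
  rcases h with rfl | rfl
  · exact pos_balanced_of_sum_natAbs_le hι (ha (-1))
  · have := pos_balanced_of_sum_natAbs_le (a := -a) hι ?_
    · simpa [Left.sign_neg, neg_eq_iff_eq_neg] using this
    · refine le_of_eq_of_le ?_ ((ha 1).trans_eq ?_)
      · simp
      · refine Finset.sum_congr rfl fun i _ => ?_
        rw [Pi.neg_apply, ← Int.natAbs_neg (a i + 1), neg_add, sub_eq_add_neg]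

end Median

/-! ### Word length as a minimal ℓ¹ norm -/

section WordLength

variable {L ι : Type*} [AddCommGroup L] [Fintype ι] {M : Set L} {v : ι → L}

theorem isSumOf_sum_zsmul (hM : ∀ y, y ∈ M ↔ ∃ i, y = v i ∨ y = -v i) (a : ι → ℤ) :
    IsSumOf M (∑ i, (a i).natAbs) (∑ i, a i • v i) :=
  IsSumOf.sum _ fun i _ => IsSumOf.zsmul ((hM _).2 ⟨i, .inl rfl⟩) ((hM _).2 ⟨i, .inr rfl⟩) _

/-- Only an inequality survives, since `v i` and `-v i` may cancel within the multiset. -/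
theorem IsSumOf.exists_sum_zsmul (hM : ∀ y, y ∈ M ↔ ∃ i, y = v i ∨ y = -v i) {n : ℕ} {x : L}
    (hx : IsSumOf M n x) : ∃ a : ι → ℤ, ∑ i, a i • v i = x ∧ ∑ i, (a i).natAbs ≤ n := by
  classical
  obtain ⟨s, hs, rfl, rfl⟩ := hx
  induction s using Multiset.induction_on with
  | empty => exact ⟨0, by simp, by simp⟩
  | cons y s ih =>
    obtain ⟨a, ha, han⟩ := ih fun z hz => hs z (by simp [hz])
    obtain ⟨i, hi⟩ := (hM y).1 (hs y (by simp))
    have step : ∀ e : ℤ, e.natAbs = 1 → y = e • v i → ∃ a : ι → ℤ,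
        ∑ i, a i • v i = (y ::ₘ s).sum ∧ ∑ i, (a i).natAbs ≤ Multiset.card (y ::ₘ s) := by
      intro e he hy
      refine ⟨a + Pi.single i e, ?_, ?_⟩
      · rw [Multiset.sum_cons, ← ha, hy]
        simp [add_smul, Finset.sum_add_distrib, Pi.single_apply, ite_smul, add_comm]
      · calc ∑ j, ((a + Pi.single i e : ι → ℤ) j).natAbs
            ≤ ∑ j, ((a j).natAbs + if j = i then 1 else 0) := by
              refine Finset.sum_le_sum fun j _ => ?_
              by_cases hj : j = i
              · subst hj
                simpa [he] using Int.natAbs_add_le (a j) e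
              · simp [hj]
          _ ≤ _ := by simpa [Finset.sum_add_distrib] using han
    rcases hi with hi | hi
    · exact step 1 rfl (by simpa using hi)
    · exact step (-1) rfl (by simpa using hi)

theorem sum_zsmul_eq_iff
    (hv : ∀ a : ι → ℤ, ∑ i, a i • v i = 0 ↔ ∃ t, ∀ i, a i = t)
    (a b : ι → ℤ) :
    ∑ i, b i • v i = ∑ i, a i • v i ↔ ∃ t, ∀ i, b i = a i + t := by
  rw [← sub_eq_zero, ← Finset.sum_sub_distrib]
  simp only [← sub_smul]
  rw [hv]
  simp only [sub_eq_iff_eq_add']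

theorem wordSphere_eq_image
    (hM : ∀ y, y ∈ M ↔ ∃ i, y = v i ∨ y = -v i)
    (hv : ∀ a : ι → ℤ, ∑ i, a i • v i = 0 ↔ ∃ t, ∀ i, a i = t)
    (hι : Odd (Fintype.card ι)) (n : ℕ) :
    wordSphere M n = (fun a : ι → ℤ => ∑ i, a i • v i) ''
      {a | IsBalanced (fun i => SignType.sign (a i)) ∧ ∑ i, (a i).natAbs = n} := by
  ext x
  constructor
  · rintro ⟨hx, hmin⟩
    obtain ⟨a, rfl, han⟩ := IsSumOf.exists_sum_zsmul hM hx
    have hn : ∑ i, (a i).natAbs = n := han.antisymm (hmin (isSumOf_sum_zsmul hM a))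
    refine ⟨a, ⟨isBalanced_of_sum_natAbs_le hι fun t => ?_, hn⟩, rfl⟩
    rw [hn]
    apply hmin
    have := isSumOf_sum_zsmul hM fun i => a i + t
    rwa [(sum_zsmul_eq_iff hv a fun i => a i + t).2 ⟨t, fun _ => rfl⟩] at this
  · rintro ⟨a, ⟨ha, rfl⟩, rfl⟩
    refine ⟨isSumOf_sum_zsmul hM a, fun k hk => ?_⟩
    obtain ⟨b, hb, hbk⟩ := IsSumOf.exists_sum_zsmul hM hk
    obtain ⟨t, ht⟩ := (sum_zsmul_eq_iff hv a b).1 hb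
    refine le_trans ?_ hbk
    simp only [ht]
    by_cases h0 : t = 0
    · simp [h0]
    · exact (sum_natAbs_lt_add ha h0).le

/-- Two distinct balanced vectors in one coset would each have strictly smaller norm than the other.
-/
theorem injOn_sum_zsmul_balanced
    (hv : ∀ a : ι → ℤ, ∑ i, a i • v i = 0 ↔ ∃ t, ∀ i, a i = t) :
    Set.InjOn (fun a : ι → ℤ => ∑ i, a i • v i)
      {a | IsBalanced fun i => SignType.sign (a i)} := by
  intro a ha b hb hab
  obtain ⟨t, ht⟩ := (sum_zsmul_eq_iff hv b a).1 hab
  by_cases h0 : t = 0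
  · funext i
    simp [ht, h0]
  · have h1 := sum_natAbs_lt_add hb h0
    have h2 := sum_natAbs_lt_add ha (neg_ne_zero.2 h0)
    simp only [ht, add_neg_cancel_right] at h2
    omega

end WordLength

/-! ### Weighted enumeration of balanced sign vectors -/

section Counting

variable {ι : Type*} [Fintype ι]

open Classical in
/-- The sum of the products of the weights `w (σ i)` over all balanced sign vectors `σ`. -/
noncomputable def balancedSum (ι : Type*) [Fintype ι] {R : Type*} [CommRing R]
    (w : SignType → R) : R :=
  ∑ σ : ι → SignType with IsBalanced σ, ∏ i, w (σ i)

/-- The fibre is a product set: entries in `P` equal `e` and weigh `x`, while each entry outside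
ranges over `{0, -e}` with total weight `(1 - x) + x = 1`. -/
theorem sum_prod_of_fiber_eq [DecidableEq ι] {R : Type*} [CommRing R] (x : R) {e : SignType}
    (he : e ≠ 0) (P : Finset ι) :
    ∑ σ : ι → SignType with (Finset.univ.filter fun i => σ i = e) = P,
      ∏ i, (if σ i = 0 then 1 - x else x) = x ^ P.card := by
  have h := Finset.prod_univ_sum (fun i : ι => if i ∈ P then {e} else ({0, -e} : Finset SignType))
    fun _ s => if s = 0 then 1 - x else x
  have h0 : (0 : SignType) ≠ -e := by clear h; revert e; decide
  have hl : ∏ i, ∑ s ∈ (if i ∈ P then {e} else ({0, -e} : Finset SignType)),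
      (if s = 0 then 1 - x else x) = x ^ P.card := by
    rw [← Finset.prod_const, ← Finset.prod_filter_mul_prod_filter_not Finset.univ (· ∈ P)]
    rw [Finset.prod_congr rfl (g := fun _ => x), Finset.prod_congr (s₁ := Finset.filter (· ∉ P) _) rfl (g := fun _ => 1),
      Finset.prod_const_one, mul_one, Finset.filter_univ_mem]
    · intro i hi
      rw [if_neg (by simpa using hi), Finset.sum_pair h0]
      simp [h0.symm]
    · intro i hi
      rw [if_pos (by simpa using hi)]
      simp [he]
  rw [← hl, h]
  refine Finset.sum_congr ?_ fun _ _ => rfl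
  ext σ
  simp only [Finset.mem_filter, Finset.mem_univ, true_and, Fintype.mem_piFinset, Finset.ext_iff]
  refine forall_congr' fun i => ?_
  by_cases hi : i ∈ P
  · simp [hi]
  · simp only [hi, iff_false, if_false]
    generalize σ i = s
    clear h hl h0
    revert e s
    decide

theorem sum_prod_all_signs [DecidableEq ι] {R : Type*} [CommRing R] (x : R) :
    ∑ σ : ι → SignType, ∏ i, (if σ i = 0 then 1 - x else x) = (1 + x) ^ Fintype.card ι := by
  have h := Finset.prod_univ_sum (fun _ : ι => (Finset.univ : Finset SignType))
    fun _ s => if s = 0 then 1 - x else x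
  rw [Fintype.piFinset_univ] at h
  rw [← h, Finset.prod_const, Finset.card_univ]
  congr 1
  rw [show (Finset.univ : Finset SignType) = {0, -1, 1} from rfl]
  simp [Finset.sum_insert]

theorem sum_upper_choose {R : Type*} [CommRing R] (x : R) (m : ℕ) :
    ∑ k ∈ Finset.range (2 * m + 1 + 1), (if m < k then ((2 * m + 1).choose k : R) * x ^ k else 0) =
      ∑ k ∈ Finset.range (m + 1), ((2 * m + 1).choose k : R) * x ^ (2 * m + 1 - k) := by
  rw [← Finset.sum_range_reflect, show 2 * m + 1 + 1 = (m + 1) + (m + 1) by ring,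
    Finset.sum_range_add]
  rw [← add_zero (∑ k ∈ Finset.range (m + 1), _ * _)]
  congr 1
  · refine Finset.sum_congr rfl fun k hk => ?_
    rw [Finset.mem_range] at hk
    rw [if_pos (by omega), show m + 1 + (m + 1) - 1 - k = 2 * m + 1 - k by omega,
      Nat.choose_symm (by omega)]
  · refine Finset.sum_eq_zero fun k hk => if_neg ?_
    omega

theorem sum_prod_of_lt_card [DecidableEq ι] {R : Type*} [CommRing R] (x : R) {m : ℕ}
    (hm : Fintype.card ι = 2 * m + 1) {e : SignType} (he : e ≠ 0) :
    ∑ σ : ι → SignType with m < (Finset.univ.filter fun i => σ i = e).card,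
      ∏ i, (if σ i = 0 then 1 - x else x) =
      ∑ k ∈ Finset.range (m + 1), ((2 * m + 1).choose k : R) * x ^ (2 * m + 1 - k) := by
  rw [← sum_upper_choose, ← hm, Finset.sum_filter,
    ← Finset.sum_fiberwise_of_maps_to (t := (Finset.univ : Finset ι).powerset)
      (g := fun σ : ι → SignType => Finset.univ.filter fun i => σ i = e) (by simp)]
  trans ∑ P ∈ (Finset.univ : Finset ι).powerset, if m < P.card then x ^ P.card else 0
  · refine Finset.sum_congr rfl fun P _ => ?_
    rw [← sum_prod_of_fiber_eq x he P]
    split_ifs with hP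
    · refine Finset.sum_congr rfl fun σ hσ => ?_
      rw [(Finset.mem_filter.1 hσ).2, if_pos hP]
    · refine Finset.sum_eq_zero fun σ hσ => ?_
      rw [(Finset.mem_filter.1 hσ).2, if_neg hP]
  · rw [Finset.sum_powerset_apply_card fun k => if m < k then x ^ k else 0, Finset.card_univ]
    refine Finset.sum_congr rfl fun k _ => ?_
    split_ifs <;> simp

theorem balancedSum_eq {R : Type*} [CommRing R] (x : R) {m : ℕ}
    (hm : Fintype.card ι = 2 * m + 1) :
    balancedSum ι (fun s => if s = 0 then 1 - x else x) =
      ∑ k ∈ Finset.range (m + 1), ((2 * m + 1).choose k : R) * x ^ k -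
      ∑ k ∈ Finset.range (m + 1), ((2 * m + 1).choose k : R) * x ^ (2 * m + 1 - k) := by
  classical
  have hall := sum_prod_all_signs (ι := ι) x
  have hsplit : (1 + x) ^ (2 * m + 1) =
      ∑ k ∈ Finset.range (m + 1), ((2 * m + 1).choose k : R) * x ^ k +
      ∑ k ∈ Finset.range (m + 1), ((2 * m + 1).choose k : R) * x ^ (2 * m + 1 - k) := by
    rw [← sum_upper_choose, add_comm 1 x, add_pow, ← Finset.sum_filter,
      ← Finset.sum_filter_add_sum_filter_not _ (fun k => m < k), add_comm]
    congr 1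
    · refine Finset.sum_congr ?_ fun k _ => by rw [one_pow, mul_one, mul_comm]
      ext k
      simp only [Finset.mem_filter, Finset.mem_range]
      omega
    · exact Finset.sum_congr rfl fun k _ => by rw [one_pow, mul_one, mul_comm]
  have hpos := sum_prod_of_lt_card (ι := ι) x hm (e := 1) (by decide)
  have hneg := sum_prod_of_lt_card (ι := ι) x hm (e := -1) (by decide)
  rw [hm, hsplit] at hall
  have hdecomp : ∑ σ : ι → SignType, ∏ i, (if σ i = 0 then 1 - x else x) =
      balancedSum ι (fun s => if s = 0 then 1 - x else x) +
      (∑ σ : ι → SignType with m < (Finset.univ.filter fun i => σ i = 1).card,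
        ∏ i, (if σ i = 0 then 1 - x else x)) +
      ∑ σ : ι → SignType with m < (Finset.univ.filter fun i => σ i = -1).card,
        ∏ i, (if σ i = 0 then 1 - x else x) := by
    rw [balancedSum, Finset.sum_filter, Finset.sum_filter, Finset.sum_filter,
      ← Finset.sum_add_distrib, ← Finset.sum_add_distrib]
    refine Finset.sum_congr rfl fun σ _ => ?_
    -- The two majorities exclude each other, so each sign vector is counted exactly once.
    have hle : (Finset.univ.filter fun i => σ i = 1).card +
        (Finset.univ.filter fun i => σ i = -1).card ≤ 2 * m + 1 := by
      rw [← hm, ← Finset.card_union_of_disjoint]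
      · exact Finset.card_le_univ _
      · refine Finset.disjoint_filter.2 fun i _ h h' => ?_
        rw [h] at h'
        exact absurd h' (by decide)
    have hbal : IsBalanced σ ↔ 2 * (Finset.univ.filter fun i => σ i = 1).card < 2 * m + 1 ∧
        2 * (Finset.univ.filter fun i => σ i = -1).card < 2 * m + 1 := by
      rw [← hm]
      refine ⟨fun h => ⟨h 1 (by decide), h (-1) (by decide)⟩, fun h e he => ?_⟩
      have h' : e = 1 ∨ e = -1 := by revert e; decide
      rcases h' with rfl | rfl
      exacts [h.1, h.2]
    rw [hbal]
    split_ifs <;> first | omega | simp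
  rw [hdecomp, hpos, hneg] at hall
  linear_combination hall

theorem balancedSum_mul_pow {R : Type*} [CommRing R] (w : SignType → R) (y : R) :
    balancedSum ι w * y ^ Fintype.card ι = balancedSum ι fun s => w s * y := by
  simp only [balancedSum, Finset.sum_mul, Finset.prod_mul_distrib, Finset.prod_const,
    Finset.card_univ]

/-- The generating function of the integers of a given sign by absolute value. -/
noncomputable def signSeries (s : SignType) : PowerSeries ℤ :=
  PowerSeries.mk fun n => if s = 0 ↔ n = 0 then 1 else 0

theorem signSeries_mul_one_sub (s : SignType) :
    signSeries s * (1 - PowerSeries.X) = if s = 0 then 1 - PowerSeries.X else PowerSeries.X := by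
  split_ifs with hs
  · rw [show signSeries s = 1 from ?_, one_mul]
    ext n
    simp [signSeries, hs, PowerSeries.coeff_one]
  · rw [show signSeries s = PowerSeries.mk 1 * PowerSeries.X from ?_, mul_right_comm,
      PowerSeries.mk_one_mul_one_sub_eq_one, one_mul]
    ext n
    cases n with
    | zero => simp [signSeries, hs]
    | succ n => simp [signSeries, hs, PowerSeries.coeff_succ_mul_X]

theorem coeff_balancedSum (n : ℕ) :
    PowerSeries.coeff n (balancedSum ι signSeries) =
      ({a : ι → ℤ | IsBalanced (fun i => SignType.sign (a i)) ∧
        ∑ i, (a i).natAbs = n}.ncard : ℤ) ∧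
    {a : ι → ℤ | IsBalanced (fun i => SignType.sign (a i)) ∧ ∑ i, (a i).natAbs = n}.Finite := by
  classical
  -- An integer vector is encoded by its signs and absolute values; the compatibility of zeros makes
  -- this faithful and matches the indicator in `signSeries`.
  set T : Finset ((ι → SignType) × (ι →₀ ℕ)) :=
    ((Finset.univ.filter fun σ : ι → SignType => IsBalanced σ) ×ˢ
      Finset.univ.finsuppAntidiag n).filter fun q => ∀ i, q.1 i = 0 ↔ q.2 i = 0 with hT
  have himg : {a : ι → ℤ | IsBalanced (fun i => SignType.sign (a i)) ∧ ∑ i, (a i).natAbs = n} =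
      (fun q : (ι → SignType) × (ι →₀ ℕ) => fun i => (q.1 i : ℤ) * (q.2 i : ℤ)) '' T := by
    ext a
    simp only [Set.mem_ofPred_eq, Set.mem_image, Finset.mem_coe, hT, Finset.mem_filter,
      Finset.mem_product, Finset.mem_univ, true_and, Finset.mem_finsuppAntidiag,
      Finset.subset_univ, and_true]
    constructor
    · rintro ⟨hb, hn⟩
      refine ⟨(fun i => SignType.sign (a i), Finsupp.equivFunOnFinite.symm fun i => (a i).natAbs),
        ⟨⟨hb, ?_⟩, ?_⟩, ?_⟩
      · simpa using hn
      · simp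
      · funext i
        simp
    · rintro ⟨⟨σ, l⟩, ⟨⟨hb, hn⟩, h0⟩, rfl⟩
      dsimp only at hb hn h0 ⊢
      have hsign : ∀ i, SignType.sign ((σ i : ℤ) * (l i : ℤ)) = σ i := by
        intro i
        have := h0 i
        rcases Nat.eq_zero_or_pos (l i) with hl | hl
        · simp [hl, this.2 hl]
        · rw [sign_mul, sign_pos (by exact_mod_cast hl : (0 : ℤ) < l i), mul_one]
          generalize σ i = s
          revert s
          decide
      refine ⟨by simpa only [hsign] using hb, ?_⟩
      rw [← hn]
      refine Finset.sum_congr rfl fun i _ => ?_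
      have := h0 i
      rw [Int.natAbs_mul, Int.natAbs_natCast]
      generalize σ i = s at this
      cases s <;> simp_all
  have hinj : Set.InjOn (fun q : (ι → SignType) × (ι →₀ ℕ) => fun i => (q.1 i : ℤ) * (q.2 i : ℤ))
      T := by
    rintro ⟨σ, l⟩ h ⟨τ, k⟩ h' heq
    have h0 : ∀ i, σ i = 0 ↔ l i = 0 := (Finset.mem_filter.1 h).2
    have h0' : ∀ i, τ i = 0 ↔ k i = 0 := (Finset.mem_filter.1 h').2
    have key : ∀ i, σ i = τ i ∧ l i = k i := by
      intro i
      have h1 := h0 i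
      have h2 := h0' i
      have h3 : (σ i : ℤ) * (l i : ℤ) = (τ i : ℤ) * (k i : ℤ) := congrFun heq i
      generalize σ i = s at *
      generalize τ i = t at *
      cases s <;> cases t <;> simp at h1 h2 h3 ⊢ <;> omega
    exact Prod.ext (funext fun i => (key i).1) (Finsupp.ext fun i => (key i).2)
  rw [himg, hinj.ncard_image, Set.ncard_coe_finset]
  refine ⟨?_, T.finite_toSet.image _⟩
  simp only [balancedSum, map_sum, PowerSeries.coeff_prod, signSeries, PowerSeries.coeff_mk]
  rw [← Finset.sum_product', hT, Finset.card_filter]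
  push_cast
  refine Finset.sum_congr rfl fun q _ => ?_
  rw [Finset.prod_ite_zero]
  simp

end Counting

/-! ### The explicit polynomial and division by `1 - X` -/

/-- The coordinator polynomial of `ℤ[ζ_{2p}]` for `p = 2 * m + 1`. -/
noncomputable def halfBinomialPolynomial (m : ℕ) : ℤ[X] :=
  ∑ k ∈ Finset.range m,
      (X ^ k + X ^ (2 * m - k)) * C (∑ j ∈ Finset.range (k + 1), ((2 * m + 1).choose j : ℤ)) +
    X ^ m * C (∑ j ∈ Finset.range (m + 1), ((2 * m + 1).choose j : ℤ))

/-- Telescoping: consecutive partial sums differ by `c k`, leaving one boundary term. -/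
theorem one_sub_X_mul_sum_partialSums {R : Type*} [CommRing R] (c : ℕ → R) (n : ℕ) :
    (1 - X) * ∑ k ∈ Finset.range n, X ^ k * C (∑ j ∈ Finset.range (k + 1), c j) =
      ∑ k ∈ Finset.range n, C (c k) * X ^ k - C (∑ j ∈ Finset.range n, c j) * X ^ n := by
  induction n with
  | zero => simp
  | succ n ih =>
    rw [Finset.sum_range_succ, mul_add, ih, Finset.sum_range_succ _ n, Finset.sum_range_succ _ n,
      C_add]
    ring

theorem one_sub_X_mul_sum_partialSums_reverse {R : Type*} [CommRing R] (c : ℕ → R) {N n : ℕ}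
    (hn : n ≤ N + 1) :
    (1 - X) * ∑ k ∈ Finset.range n, X ^ (N - k) * C (∑ j ∈ Finset.range (k + 1), c j) =
      C (∑ j ∈ Finset.range n, c j) * X ^ (N + 1 - n) -
        ∑ k ∈ Finset.range n, C (c k) * X ^ (N + 1 - k) := by
  induction n with
  | zero => simp
  | succ n ih =>
    rw [Finset.sum_range_succ, mul_add, ih (by omega), Finset.sum_range_succ _ n,
      Finset.sum_range_succ _ n, C_add, show N + 1 - n = N - n + 1 by omega,
      show N + 1 - (n + 1) = N - n by omega]
    ring

theorem one_sub_X_mul_halfBinomialPolynomial (m : ℕ) :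
    (1 - X) * halfBinomialPolynomial m =
      ∑ k ∈ Finset.range (m + 1), ((2 * m + 1).choose k : ℤ[X]) * X ^ k -
      ∑ k ∈ Finset.range (m + 1), ((2 * m + 1).choose k : ℤ[X]) * X ^ (2 * m + 1 - k) := by
  have h1 := one_sub_X_mul_sum_partialSums (fun j => ((2 * m + 1).choose j : ℤ)) (m + 1)
  have h2 := one_sub_X_mul_sum_partialSums_reverse (fun j => ((2 * m + 1).choose j : ℤ))
    (N := 2 * m) (n := m) (by omega)
  rw [Finset.sum_range_succ] at h1
  simp only [halfBinomialPolynomial, add_mul, Finset.sum_add_distrib]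
  simp only [eq_intCast, Int.cast_natCast] at h1 h2 ⊢
  rw [show 2 * m + 1 - m = m + 1 by omega] at h2
  -- The boundary terms of `h1` and `h2` at `X ^ (m + 1)` differ by this middle binomial, which is
  -- the last term of the reversed sum.
  have h3 : ((∑ j ∈ Finset.range (m + 1), ((2 * m + 1).choose j : ℤ) : ℤ) : ℤ[X]) =
      ((∑ j ∈ Finset.range m, ((2 * m + 1).choose j : ℤ) : ℤ) : ℤ[X]) + (2 * m + 1).choose m := by
    rw [Finset.sum_range_succ, Int.cast_add, Int.cast_natCast]
  rw [Finset.sum_range_succ (fun k => ((2 * m + 1).choose k : ℤ[X]) * X ^ (2 * m + 1 - k)),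
    show 2 * m + 1 - m = m + 1 by omega]
  linear_combination h1 + h2 - X ^ (m + 1) * h3

theorem natDegree_halfBinomialPolynomial_le (m : ℕ) :
    (halfBinomialPolynomial m).natDegree ≤ 2 * m := by
  refine natDegree_add_le_of_degree_le (natDegree_sum_le_of_forall_le _ _ fun k hk => ?_) ?_
  · rw [Finset.mem_range] at hk
    refine (natDegree_mul_C_le _ _).trans (natDegree_add_le_of_degree_le ?_ ?_) <;>
      rw [natDegree_X_pow] <;> omega
  · refine (natDegree_mul_C_le _ _).trans ?_
    rw [natDegree_X_pow]
    omega

theorem coeff_halfBinomialPolynomial (m : ℕ) : (halfBinomialPolynomial m).coeff m = 4 ^ m := by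
  rw [halfBinomialPolynomial, coeff_add, finsetSum_coeff, Finset.sum_eq_zero, zero_add,
    coeff_mul_C, coeff_X_pow_self, one_mul]
  · exact_mod_cast Nat.sum_range_choose_halfway m
  · intro k hk
    rw [Finset.mem_range] at hk
    rw [coeff_mul_C, coeff_add, coeff_X_pow, coeff_X_pow, if_neg (by omega), if_neg (by omega)]
    simp

theorem balancedSum_signSeries_mul {ι : Type*} [Fintype ι] {m : ℕ}
    (hm : Fintype.card ι = 2 * m + 1) :
    balancedSum ι signSeries * (1 - PowerSeries.X) ^ (2 * m) =
      (halfBinomialPolynomial m : PowerSeries ℤ) := by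
  have hne : (1 - PowerSeries.X : PowerSeries ℤ) ≠ 0 := fun h => by
    simpa [h] using PowerSeries.mk_one_mul_one_sub_eq_one ℤ
  -- The rank is one less than the number of coordinates; the extra factor gives every coordinate
  -- its own `1 - X`.
  refine mul_right_cancel₀ hne ?_
  rw [mul_assoc, ← pow_succ, ← hm, balancedSum_mul_pow]
  simp only [signSeries_mul_one_sub]
  rw [balancedSum_eq _ hm]
  have h := congrArg (Polynomial.coeToPowerSeries.ringHom (R := ℤ))
    (one_sub_X_mul_halfBinomialPolynomial m)
  simp only [map_mul, map_sub, map_one, map_sum, map_pow, map_natCast,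
    Polynomial.coeToPowerSeries.ringHom_apply, Polynomial.coe_X] at h
  rw [← h, mul_comm]

/-- The growth series of a quotient of `ℤ^ι`, with `ι` of odd size, by the constant vectors. -/
theorem growthSeries_eq_balancedSum {L ι : Type*} [AddCommGroup L] [Fintype ι] {M : Set L}
    {v : ι → L} (hM : ∀ y, y ∈ M ↔ ∃ i, y = v i ∨ y = -v i)
    (hv : ∀ a : ι → ℤ, ∑ i, a i • v i = 0 ↔ ∃ t, ∀ i, a i = t) (hι : Odd (Fintype.card ι)) :
    growthSeries M = balancedSum ι signSeries := by
  ext n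
  rw [growthSeries, PowerSeries.coeff_mk, (coeff_balancedSum n).1, coordinationSequence,
    wordSphere_eq_image hM hv hι, ((injOn_sum_zsmul_balanced hv).mono fun a ha => ha.1).ncard_image]

/-! ### Roots of unity and the cyclotomic lattice -/

theorem IsPrimitiveRoot.sum_zsmul_pow_eq_zero_iff {K : Type*} [Field K] [CharZero K] {p : ℕ}
    (hp : p.Prime) {ζ : K} (hζ : IsPrimitiveRoot ζ p) (a : Fin p → ℤ) :
    ∑ i, a i • ζ ^ (i : ℕ) = 0 ↔ ∃ t, ∀ i, a i = t := by
  have hgeom : ∑ i : Fin p, ζ ^ (i : ℕ) = 0 := by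
    rw [Fin.sum_univ_eq_sum_range fun i => ζ ^ i]
    exact hζ.geom_sum_eq_zero hp.one_lt
  constructor
  · intro h
    -- Subtracting the last coefficient kills the term of degree `p - 1`, so `f` is too short to be
    -- a nonzero multiple of the cyclotomic polynomial.
    set b : Fin p → ℤ := fun i => a i - a ⟨p - 1, by have := hp.pos; omega⟩ with hb
    set f : ℤ[X] := ∑ i, C (b i) * X ^ (i : ℕ) with hf
    have haeval : aeval ζ f = 0 := by
      simp only [zsmul_eq_mul] at h
      simp [hf, hb, sub_mul, Finset.sum_sub_distrib, h, ← Finset.mul_sum, hgeom]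
    have hdvd : cyclotomic p ℤ ∣ f := by
      rw [cyclotomic_eq_minpoly hζ hp.pos]
      exact minpoly.isIntegrallyClosed_dvd (hζ.isIntegral hp.pos) haeval
    have hdeg : f.degree < (cyclotomic p ℤ).degree := by
      rw [degree_cyclotomic, Nat.totient_prime hp]
      refine (degree_lt_iff_coeff_zero _ _).2 fun n hn => ?_
      simp only [hf, finsetSum_coeff, coeff_C_mul, coeff_X_pow]
      refine Finset.sum_eq_zero fun i _ => ?_
      split_ifs with hi
      · have : i = ⟨p - 1, by have := hp.pos; omega⟩ := Fin.ext (by simp only; omega)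
        simp [hb, this]
      · simp
    have hf0 : f = 0 := by
      by_contra hne
      exact absurd (degree_le_of_dvd hdvd hne) (not_le.2 hdeg)
    refine ⟨a ⟨p - 1, by have := hp.pos; omega⟩, fun i => ?_⟩
    have hc := congrArg (fun q : ℤ[X] => q.coeff i) hf0
    simp only [hf, finsetSum_coeff, coeff_C_mul, coeff_X_pow, coeff_zero, Fin.val_inj,
      mul_ite, mul_one, mul_zero, Finset.sum_ite_eq, Finset.mem_univ, if_true] at hc
    exact sub_eq_zero.1 hc
  · rintro ⟨t, ht⟩
    simp only [ht, ← Finset.smul_sum, hgeom, smul_zero]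

theorem IsPrimitiveRoot.pow_two_mul_eq_one_iff {R : Type*} [CommRing R] [IsDomain R] {p : ℕ}
    (hp : Odd p) {ζ : R} (hζ : IsPrimitiveRoot ζ p) (y : R) :
    y ^ (2 * p) = 1 ↔ ∃ i : Fin p, y = ζ ^ (i : ℕ) ∨ y = -ζ ^ (i : ℕ) := by
  have : NeZero p := ⟨hp.pos.ne'⟩
  constructor
  · intro h
    rw [mul_comm, pow_mul, sq_eq_one_iff] at h
    rcases h with h | h
    · obtain ⟨i, hi, rfl⟩ := hζ.eq_pow_of_pow_eq_one h
      exact ⟨⟨i, hi⟩, .inl rfl⟩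
    · obtain ⟨i, hi, h'⟩ := hζ.eq_pow_of_pow_eq_one (ξ := -y) (by rw [hp.neg_pow, h, neg_neg])
      exact ⟨⟨i, hi⟩, .inr (by rw [h', neg_neg])⟩
  · have hpow : ∀ i : ℕ, (ζ ^ i) ^ (2 * p) = 1 := fun i => by
      rw [← pow_mul, show i * (2 * p) = p * (2 * i) by ring, pow_mul, hζ.pow_eq_one, one_pow]
    rintro ⟨i, rfl | rfl⟩
    · exact hpow i
    · rw [(even_two_mul p).neg_pow, hpow]

section CyclotomicLattice

variable {m : ℕ}

/-- The generator `e^{2πi/m}` of `ℤ[ζ_m]`. -/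
noncomputable def cyclotomicLatticeGen (m : ℕ) : cyclotomicLattice m :=
  ⟨Complex.exp (2 * Real.pi * Complex.I / m), Algebra.self_mem_adjoin_singleton _ _⟩

theorem isPrimitiveRoot_cyclotomicLatticeGen (hm : m ≠ 0) :
    IsPrimitiveRoot (cyclotomicLatticeGen m) m :=
  (Complex.isPrimitiveRoot_exp m hm).of_map_of_injective (f := (cyclotomicLattice m).val)
    Subtype.val_injective

/-- The power basis of `ℤ[ζ_m]` given by the powers of `ζ_m`. -/
noncomputable def cyclotomicLatticePowerBasis (hm : m ≠ 0) : PowerBasis ℤ (cyclotomicLattice m) :=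
  Algebra.adjoin.powerBasis'
    ((Complex.isPrimitiveRoot_exp m hm).isIntegral (Nat.pos_of_ne_zero hm))

theorem finrank_cyclotomicLattice (hm : m ≠ 0) :
    Module.finrank ℤ (cyclotomicLattice m) = m.totient := by
  rw [(cyclotomicLatticePowerBasis hm).finrank, cyclotomicLatticePowerBasis,
    Algebra.adjoin.powerBasis'_dim,
    ← cyclotomic_eq_minpoly (Complex.isPrimitiveRoot_exp m hm) (Nat.pos_of_ne_zero hm),
    natDegree_cyclotomic]

/-- The roots of unity form a multiplicative monoid, so their additive closure is closed under
products; it contains `-1` because `m` is even. -/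
theorem closure_cyclotomicGenerators (hm : m ≠ 0) (heven : Even m) :
    AddSubmonoid.closure (cyclotomicGenerators m) = ⊤ := by
  let S : Submonoid (cyclotomicLattice m) := MonoidHom.mker (powMonoidHom m)
  have hS : cyclotomicGenerators m = (S : Set (cyclotomicLattice m)) := by
    ext x
    simp [S, cyclotomicGenerators, MonoidHom.mem_mker]
  rw [hS, eq_top_iff]
  have hone : (1 : cyclotomicLattice m) ∈ AddSubmonoid.closure (S : Set (cyclotomicLattice m)) :=
    AddSubmonoid.subset_closure S.one_mem
  have hneg : (-1 : cyclotomicLattice m) ∈ AddSubmonoid.closure (S : Set (cyclotomicLattice m)) :=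
    AddSubmonoid.subset_closure (by simp [S, MonoidHom.mem_mker, heven.neg_pow])
  rintro ⟨x, hx⟩ -
  refine Algebra.adjoin_induction
    (p := fun x hx => (⟨x, hx⟩ : cyclotomicLattice m) ∈
      AddSubmonoid.closure (S : Set (cyclotomicLattice m))) ?_ ?_ ?_ ?_ hx
  · intro x hx
    obtain rfl := Set.mem_singleton_iff.1 hx
    exact AddSubmonoid.subset_closure (isPrimitiveRoot_cyclotomicLatticeGen hm).pow_eq_one
  · intro n
    have h : (algebraMap ℤ (cyclotomicLattice m) n) ∈
        AddSubmonoid.closure (S : Set (cyclotomicLattice m)) := by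
      rcases Int.natAbs_eq n with h | h <;> rw [h]
      · simpa using nsmul_mem hone n.natAbs
      · simpa using nsmul_mem hneg n.natAbs
    exact h
  · intro x y hx hy h h'
    exact add_mem h h'
  · intro x y hx hy h h'
    exact MulMemClass.mul_mem_add_closure h h'

end CyclotomicLattice

theorem isCoordinatorPolynomial_cyclotomicLattice {m : ℕ} (hp : (2 * m + 1).Prime) :
    IsCoordinatorPolynomial (cyclotomicLattice (2 * (2 * m + 1)))
      (cyclotomicGenerators (2 * (2 * m + 1))) (halfBinomialPolynomial m) := by
  have hne : 2 * (2 * m + 1) ≠ 0 := by omega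
  have hodd : Odd (2 * m + 1) := odd_two_mul_add_one m
  have hcard : Fintype.card (Fin (2 * m + 1)) = 2 * m + 1 := Fintype.card_fin _
  have hoddcard : Odd (Fintype.card (Fin (2 * m + 1))) := hcard.symm ▸ hodd
  set ζ := cyclotomicLatticeGen (2 * (2 * m + 1)) ^ 2
  have hζ : IsPrimitiveRoot ζ (2 * m + 1) :=
    (isPrimitiveRoot_cyclotomicLatticeGen hne).pow (Nat.pos_of_ne_zero hne) rfl
  have hM : ∀ y, y ∈ cyclotomicGenerators (2 * (2 * m + 1)) ↔
      ∃ i : Fin (2 * m + 1), y = ζ ^ (i : ℕ) ∨ y = -ζ ^ (i : ℕ) :=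
    hζ.pow_two_mul_eq_one_iff hodd
  have hv : ∀ a : Fin (2 * m + 1) → ℤ, ∑ i, a i • ζ ^ (i : ℕ) = 0 ↔ ∃ t, ∀ i, a i = t := by
    intro a
    have hinj : Function.Injective (cyclotomicLattice (2 * (2 * m + 1))).val :=
      Subtype.val_injective
    rw [← (hζ.map_of_injective hinj).sum_zsmul_pow_eq_zero_iff hp a,
      ← map_eq_zero_iff (cyclotomicLattice (2 * (2 * m + 1))).val hinj]
    simp only [map_sum, map_zsmul, map_pow]
  have hrank : Module.finrank ℤ (cyclotomicLattice (2 * (2 * m + 1))) = 2 * m := by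
    rw [finrank_cyclotomicLattice hne, Nat.totient_two_mul_of_odd hodd, Nat.totient_prime hp,
      Nat.add_sub_cancel]
  exact
    { free := .of_basis (cyclotomicLatticePowerBasis hne).basis
      finite := (cyclotomicLatticePowerBasis hne).finite
      generates := closure_cyclotomicGenerators hne (even_two_mul _)
      finite_sphere := fun n => by
        rw [wordSphere_eq_image hM hv hoddcard]
        exact (coeff_balancedSum n).2.image _
      natDegree_le := (natDegree_halfBinomialPolynomial_le m).trans_eq hrank.symm
      growth_eq := by
        rw [growthSeries_eq_balancedSum hM hv hoddcard, hrank,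
          balancedSum_signSeries_mul hcard] }

theorem mainTheorem3 (p : ℕ) (hp : p.Prime) (hodd : p ≠ 2) :
    ∃ h : ℤ[X],
      IsCoordinatorPolynomial (cyclotomicLattice (2 * p)) (cyclotomicGenerators (2 * p)) h ∧
      h = ∑ k ∈ Finset.range ((p - 3) / 2 + 1),
            (X ^ k + X ^ (p - 1 - k)) * C (∑ j ∈ Finset.range (k + 1), (p.choose j : ℤ)) +
          X ^ ((p - 1) / 2) * C (∑ j ∈ Finset.range ((p - 1) / 2 + 1), (p.choose j : ℤ)) ∧
      h.coeff ((p - 1) / 2) = 2 ^ (p - 1) := by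
  obtain ⟨m, rfl⟩ := hp.odd_of_ne_two hodd
  -- At `m = 0` truncated subtraction would make the range `(p - 3) / 2 + 1` equal to `1` instead of
  -- `m`.
  have hm : 0 < m := by
    rcases Nat.eq_zero_or_pos m with rfl | h
    · exact absurd hp (by decide)
    · exact h
  refine ⟨halfBinomialPolynomial m, isCoordinatorPolynomial_cyclotomicLattice hp, ?_, ?_⟩
  · rw [halfBinomialPolynomial, show (2 * m + 1 - 3) / 2 + 1 = m by omega,
      show (2 * m + 1 - 1) / 2 = m by omega]
    simp only [show ∀ k, 2 * m + 1 - 1 - k = 2 * m - k from fun k => by omega]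
  · rw [show (2 * m + 1 - 1) / 2 = m by omega, coeff_halfBinomialPolynomial,
      Nat.add_sub_cancel, pow_mul]
    norm_num
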